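/- Consider $n$ strictly periodic tasks $\tau_1,\dots,\tau_n$ with periods $T_i>0$, relative deadlines $D_i=T_i$, arbitrary first release times $\varphi_i\ge 0$, and pairwise distinct fixed priorities; the $j$-th job of $\tau_i$ ($j=0,1,\dots$) is released at $\varphi_i+jT_i$. Each job of $\tau_i$ consists of a coarse subtask with worst-case execution time (WCET) $C_i>0$, and a set $\mathcal B$ of at least two coarse subtasks of different tasks can also be executed as one batch, with WCET $C_{\mathcal B}>0$, where $C_{\mathcal B}\le\sum_{\tau_i\in\mathcal B}C_i$. All executions take place on one platform, non-preemptively, and take a positive time that is at most the respective WCET; jobs of the same task are served in order of release. A scheduling instant is a time at which the platform is free and some coarse job is pending, i.e. the completion of an execution if jobs are then pending, or otherwise the next job arrival. Let $\mathrm{HP}(\tau_i)$ and $\mathrm{LP}(\tau_i)$ be the sets of tasks of higher and of lower priority than $\tau_i$, and let $B_i=\max(\{0\}\cup\{C_j:\tau_j\in \mathrm{LP}(\tau_i)\})$. Suppose that the task set is deemed schedulable under individual non-preemptive fixed-priority execution of coarse subtasks ($\mathrm{NPFP}^{\mathsf C}$) by the response-time test, that is, for every $i$ the iteration $$R_i(0)=C_i+B_i,\qquad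 R_i(x+1)=C_i+B_i+\sum_{\tau_h\in \mathrm{HP}(\tau_i)}\left\lceil\frac{R_i(x)}{T_h}\right\rceil C_h$$ reaches a value $R_i=R_i(x)=R_i(x+1)$ with $R_i\le T_i$. Then the task set is schedulable under $\mathrm{NPFP}^{\mathsf{[C]}}$: for all first release times and all execution times as above, every coarse job is completed by its deadline. Here $\mathrm{NPFP}^{\mathsf{[C]}}$ is the following policy. At a scheduling instant $t$, let $\tau^S(t)$ be the set of tasks with an active (released and uncompleted) coarse job, and call a set $\mathcal B\subseteq\tau^S(t)$ with $|\mathcal B|\ge 2$ permissible if (P1) it consists of the $|\mathcal B|$ highest-priority tasks of $\tau^S(t)$, and (P2) $C_{\mathcal B}\le \min_{1\le i\le n} r_i(t)-t$, where $r_i(t)$ is the next release time of $\tau_i$. The policy executes the largest permissible batch if there is one, and otherwise the single highest-priority active coarse subtask. The conclusion holds both when $r_i(t)$ is the earliest release of $\tau_i$ strictly after $t$ and when it is the earliest release at or after $t$; it also holds (with $r_i(t)$ strictly after $t$) for every policy that at each scheduling instant executes either some permissible batch or the single highest-priority active coarse subtask. -/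

import Mathlib

open Finset

noncomputable section

/-- The coarse part of a task set of `n` periodic tasks with implicit deadlines. A smaller value of
`prio` means a higher priority. `C i` is the WCET of the coarse subtask of task `i` run alone, and
`CB B` is the WCET of the batched execution of the coarse subtasks in `B`; the table `CB` is only
meaningful for sets of at least two tasks. -/
structure TaskSet (n : ℕ) where
  T : Fin n → ℝ
  T_pos : ∀ i, 0 < T i
  C : Fin n → ℝ
  C_pos : ∀ i, 0 < C i
  CB : Finset (Fin n) → ℝ
  CB_pos : ∀ B : Finset (Fin n), 2 ≤ B.card → 0 < CB B
  prio : Fin n → ℕ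
  prio_injective : Function.Injective prio

namespace TaskSet

variable {n : ℕ} (τ : TaskSet n)

/-- Batching property: a batch takes at most as long as its members one after the other. -/
def BatchingProperty : Prop :=
  ∀ B : Finset (Fin n), 2 ≤ B.card → τ.CB B ≤ ∑ i ∈ B, τ.C i

/-- Tasks of higher priority than `i`. -/
def HP (i : Fin n) : Finset (Fin n) := univ.filter fun h => τ.prio h < τ.prio i

/-- Tasks of lower priority than `i`. -/
def LP (i : Fin n) : Finset (Fin n) := univ.filter fun l => τ.prio i < τ.prio l

/-- Maximal blocking by one lower-priority coarse subtask. -/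
def blocking (i : Fin n) : ℝ :=
  (insert 0 ((τ.LP i).image τ.C)).max' (insert_nonempty _ _)

/-- The response-time iteration. -/
def rtaIter (i : Fin n) : ℕ → ℝ
  | 0 => τ.C i + τ.blocking i
  | x + 1 => τ.C i + τ.blocking i
      + ∑ h ∈ τ.HP i, ((⌈rtaIter i x / τ.T h⌉ : ℤ) : ℝ) * τ.C h

/-- `R` is the value at which the response-time iteration of task `i` converges. -/
def IsResponseTimeBound (i : Fin n) (R : ℝ) : Prop :=
  ∃ x : ℕ, τ.rtaIter i (x + 1) = τ.rtaIter i x ∧ R = τ.rtaIter i x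

/-- The offline test by which the task set is deemed schedulable under individual, non-preemptive,
fixed-priority execution of the coarse subtasks. -/
def PassesResponseTimeTest : Prop :=
  ∀ i, ∃ R, τ.IsResponseTimeBound i R ∧ R ≤ τ.T i

/-- Release time of job `j` (`j = 0, 1, …`) of task `i`, for the vector `φ` of first releases. -/
def release (φ : Fin n → ℝ) (i : Fin n) (j : ℕ) : ℝ := φ i + j * τ.T i

/-- Absolute deadline of job `j` of task `i`; relative deadlines equal periods. -/
def deadline (φ : Fin n → ℝ) (i : Fin n) (j : ℕ) : ℝ := τ.release φ i j + τ.T i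

/-- Earliest release of task `i` strictly after `t`. -/
def releaseAfter (φ : Fin n → ℝ) (i : Fin n) (t : ℝ) : ℝ :=
  sInf {r | ∃ j : ℕ, r = τ.release φ i j ∧ t < r}

/-- Earliest release of task `i` at or after `t`. -/
def releaseAtOrAfter (φ : Fin n → ℝ) (i : Fin n) (t : ℝ) : ℝ :=
  sInf {r | ∃ j : ℕ, r = τ.release φ i j ∧ t ≤ r}

/-- `B` consists of the `B.card` highest-priority tasks of `A`. -/
def IsTopPrefix (A B : Finset (Fin n)) : Prop :=
  B ⊆ A ∧ ∀ i ∈ B, ∀ h ∈ A, τ.prio h < τ.prio i → h ∈ B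

/-- `B` may be run as a batch at time `t` when the tasks with an active coarse subtask are those in
`A` and the next release of task `i` is `r i`: (P1) `B` is a highest-priority prefix of `A` with at
least two members, and (P2) the batch, started at `t`, ends by the next release of every task. -/
def IsPermissibleBatch (r : Fin n → ℝ) (t : ℝ) (A B : Finset (Fin n)) : Prop :=
  2 ≤ B.card ∧ τ.IsTopPrefix A B ∧ ∀ i, τ.CB B ≤ r i - t

/-- `B` is the single highest-priority task of `A`. -/
def IsSingleTop (A B : Finset (Fin n)) : Prop :=
  B.card = 1 ∧ τ.IsTopPrefix A B

/-- The coarse batch algorithm: run the largest permissible batch if there is one, otherwise the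
single highest-priority active coarse subtask. -/
def AlgorithmChoice (r : Fin n → ℝ) (t : ℝ) (A B : Finset (Fin n)) : Prop :=
  (τ.IsPermissibleBatch r t A B ∧ ∀ B', τ.IsPermissibleBatch r t A B' → B'.card ≤ B.card) ∨
    ((∀ B', ¬ τ.IsPermissibleBatch r t A B') ∧ τ.IsSingleTop A B)

/-- Any choice compatible with (P1) and (P2): some permissible batch, or the single highest-priority
active coarse subtask. -/
def AnyPermissibleChoice (r : Fin n → ℝ) (t : ℝ) (A B : Finset (Fin n)) : Prop :=
  τ.IsPermissibleBatch r t A B ∨ τ.IsSingleTop A B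

/-- WCET of one non-preemptive execution of the set `B` of coarse subtasks, batched or single. -/
def wcet (B : Finset (Fin n)) : ℝ := if 2 ≤ B.card then τ.CB B else ∑ i ∈ B, τ.C i

end TaskSet

/-- A record of the successive non-preemptive executions on the platform: the `m`-th one starts at
`start m`, lasts `dur m`, and runs one job of each task in `batch m`. -/
structure Run (n : ℕ) where
  start : ℕ → ℝ
  dur : ℕ → ℝ
  batch : ℕ → Finset (Fin n)

namespace Run

variable {n : ℕ} (ρ : Run n)

/-- Completion time of the `m`-th execution. -/
def finish (m : ℕ) : ℝ := ρ.start m + ρ.dur m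

/-- The time from which the platform is free for the `m`-th execution; the system starts at `0`. -/
def freeFrom : ℕ → ℝ
  | 0 => 0
  | m + 1 => ρ.finish m

/-- Number of jobs of task `i` completed by the executions before the `m`-th. Jobs of one task are
served in order of release, so this is also the index of the oldest uncompleted job of `i`. -/
def completed (m : ℕ) (i : Fin n) : ℕ := ((range m).filter fun k => i ∈ ρ.batch k).card

/-- Tasks that have a released and uncompleted coarse job at time `t`, when exactly the executions
before the `m`-th are completed. -/
def active (τ : TaskSet n) (φ : Fin n → ℝ) (m : ℕ) (t : ℝ) : Finset (Fin n) :=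
  univ.filter fun i => τ.release φ i (ρ.completed m i) ≤ t

/-- `ρ` is a run of the task set `τ` with first releases `φ` under the scheduling rule `choice`,
where `choice t A B` says that `B` may be executed at the scheduling instant `t` when the active
tasks are `A`. A scheduling instant is the completion of the previous execution if some job is then
pending, and otherwise the next arrival. Actual execution times are positive and at most the WCET. -/
structure Follows (τ : TaskSet n) (φ : Fin n → ℝ)
    (choice : ℝ → Finset (Fin n) → Finset (Fin n) → Prop) : Prop where
  start_least : ∀ m,
    IsLeast {t | ρ.freeFrom m ≤ t ∧ (ρ.active τ φ m t).Nonempty} (ρ.start m)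
  batch_chosen : ∀ m, choice (ρ.start m) (ρ.active τ φ m (ρ.start m)) (ρ.batch m)
  dur_pos : ∀ m, 0 < ρ.dur m
  dur_le : ∀ m, ρ.dur m ≤ τ.wcet (ρ.batch m)

/-- Every job of every task is executed and completed by its deadline. -/
def MeetsAllDeadlines (τ : TaskSet n) (φ : Fin n → ℝ) : Prop :=
  ∀ i j, ∃ m, i ∈ ρ.batch m ∧ ρ.completed m i = j ∧ ρ.finish m ≤ τ.deadline φ i j

end Run

/-- All jobs meet their deadlines in every run under the given scheduling rule (which may look at
the first releases), for all nonnegative first releases and all execution times up to the WCETs. -/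
def TaskSet.Schedulable {n : ℕ} (τ : TaskSet n)
    (rule : (Fin n → ℝ) → ℝ → Finset (Fin n) → Finset (Fin n) → Prop) : Prop :=
  ∀ φ : Fin n → ℝ, (∀ i, 0 ≤ φ i) → ∀ ρ : Run n, ρ.Follows τ φ (rule φ) → ρ.MeetsAllDeadlines τ φ

end

/-! A busy-window argument, by induction on priority. Let `k` be the last `Quiet` execution for `i`
up to a given one. From its start the platform does not idle, so the elapsed time is at most one
blocking plus the work of the `HEP i` jobs run since; the fixed point of the iteration keeps the
window below `R ≤ T i` (`finish_le_of_window`, `start_lt_of_window`). The danger is a batch with a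
member of lower priority. By (P1) it contains every pending task of `HEP i`, by (P2) it ends by
every next release, and no such task has two jobs pending (`start_lt_release_succ`), so the next
execution is quiet (`quiet_succ_of_permissible`). It can thus only close a window, and there (P2)
itself gives the deadline, which is the next release of `i`. Batches inside `HEP i` are paid for by
the batching property. -/

noncomputable section

namespace TaskSet

variable {n : ℕ} (τ : TaskSet n)

/-! ### Response-time iteration. -/

theorem blocking_nonneg (i : Fin n) : 0 ≤ τ.blocking i :=
  le_max' _ _ (mem_insert_self _ _)

theorem le_blocking {i l : Fin n} (h : τ.prio i < τ.prio l) : τ.C l ≤ τ.blocking i :=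
  le_max' _ _ (mem_insert_of_mem (mem_image_of_mem _ (by simpa [LP] using h)))

theorem rtaIter_pos (i : Fin n) (x : ℕ) : 0 < τ.rtaIter i x := by
  have h0 : 0 < τ.C i + τ.blocking i := add_pos_of_pos_of_nonneg (τ.C_pos i) (τ.blocking_nonneg i)
  induction x with
  | zero => exact h0
  | succ x ih =>
    refine add_pos_of_pos_of_nonneg h0 (sum_nonneg fun h _ => mul_nonneg ?_ (τ.C_pos h).le)
    exact_mod_cast Int.ceil_nonneg (div_nonneg ih.le (τ.T_pos h).le)

/-- Tasks of priority at least that of `i`. -/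
def HEP (i : Fin n) : Finset (Fin n) := univ.filter fun h => τ.prio h ≤ τ.prio i

theorem mem_HEP {i h : Fin n} : h ∈ τ.HEP i ↔ τ.prio h ≤ τ.prio i := by simp [HEP]

theorem HEP_eq_insert (i : Fin n) : τ.HEP i = insert i (τ.HP i) := by
  ext h
  simp only [mem_HEP, mem_insert, HP, mem_filter, mem_univ, true_and]
  constructor
  · intro hh
    exact hh.eq_or_lt.imp (fun e => τ.prio_injective e) id
  · rintro (rfl | hh)
    exacts [le_rfl, hh.le]

/-- A response-time bound within the period bounds the length of a busy window of the tasks of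
priority at least that of `i`, including the jobs of `i` itself. -/
theorem exists_busy_window_bound (htest : τ.PassesResponseTimeTest) (i : Fin n) :
    ∃ R, 0 < R ∧ R ≤ τ.T i ∧
      τ.blocking i + ∑ h ∈ τ.HEP i, ((⌈R / τ.T h⌉ : ℤ) : ℝ) * τ.C h ≤ R := by
  obtain ⟨R, ⟨x, hx, rfl⟩, hT⟩ := htest i
  refine ⟨_, τ.rtaIter_pos i x, hT, ?_⟩
  -- As `R ≤ T i`, the window holds at most one job of `i`, which the leading `C i` of the iteration
  -- pays for.
  have hi : (⌈τ.rtaIter i x / τ.T i⌉ : ℤ) ≤ 1 := by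
    rw [Int.ceil_le, div_le_iff₀ (τ.T_pos i)]
    simpa using hT
  have hi' : ((⌈τ.rtaIter i x / τ.T i⌉ : ℤ) : ℝ) * τ.C i ≤ 1 * τ.C i :=
    mul_le_mul_of_nonneg_right (by exact_mod_cast hi) (τ.C_pos i).le
  rw [HEP_eq_insert, sum_insert (by simp [HP])]
  have hfix : τ.C i + τ.blocking i
      + ∑ h ∈ τ.HP i, ((⌈τ.rtaIter i x / τ.T h⌉ : ℤ) : ℝ) * τ.C h = τ.rtaIter i x := hx
  linarith

/-! ### Release times and comparison of rules. -/

theorem release_succ (φ : Fin n → ℝ) (i : Fin n) (j : ℕ) :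
    τ.release φ i (j + 1) = τ.release φ i j + τ.T i := by
  simp only [release]; push_cast; ring

theorem release_strictMono (φ : Fin n → ℝ) (i : Fin n) : StrictMono (τ.release φ i) :=
  strictMono_nat_of_lt_succ fun j => by
    rw [release_succ]; exact lt_add_of_pos_right _ (τ.T_pos i)

theorem exists_lt_release (φ : Fin n → ℝ) (i : Fin n) (t : ℝ) : ∃ j, t < τ.release φ i j := by
  obtain ⟨j, hj⟩ := exists_nat_gt ((t - φ i) / τ.T i)
  rw [div_lt_iff₀ (τ.T_pos i)] at hj
  exact ⟨j, by simp only [release]; linarith⟩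

theorem releaseAfter_le {φ : Fin n → ℝ} {i : Fin n} {t : ℝ} {j : ℕ} (h : t < τ.release φ i j) :
    τ.releaseAfter φ i t ≤ τ.release φ i j :=
  csInf_le ⟨t, by rintro r ⟨_, _, hr⟩; exact hr.le⟩ ⟨j, rfl, h⟩

theorem releaseAtOrAfter_le_releaseAfter (φ : Fin n → ℝ) (i : Fin n) (t : ℝ) :
    τ.releaseAtOrAfter φ i t ≤ τ.releaseAfter φ i t := by
  obtain ⟨j, hj⟩ := τ.exists_lt_release φ i t
  exact csInf_le_csInf ⟨t, by rintro r ⟨_, _, hr⟩; exact hr⟩ ⟨_, j, rfl, hj⟩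
    (by rintro r ⟨k, hk, hr⟩; exact ⟨k, hk, hr.le⟩)

/-- At most `⌈R / T h⌉` jobs of `h` are released in a half-open window of length `R`. -/
theorem jobs_in_window_le {φ : Fin n → ℝ} {h : Fin n} {t R : ℝ} {c d : ℕ}
    (hc : t ≤ τ.release φ h c) (hd : τ.release φ h d < t + R) :
    (d : ℝ) - c + 1 ≤ ((⌈R / τ.T h⌉ : ℤ) : ℝ) := by
  simp only [release] at hc hd
  have h1 : (((d : ℤ) - c : ℤ) : ℝ) < R / τ.T h := by
    rw [lt_div_iff₀ (τ.T_pos h)]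
    push_cast
    linarith
  have h2 : ((d : ℤ) - c) + 1 ≤ ⌈R / τ.T h⌉ := Int.add_one_le_iff.2 (Int.lt_ceil.2 h1)
  exact_mod_cast h2

theorem AlgorithmChoice.anyPermissibleChoice {r r' : Fin n → ℝ} (hr : ∀ i, r i ≤ r' i) {t : ℝ}
    {A B : Finset (Fin n)} (h : τ.AlgorithmChoice r t A B) : τ.AnyPermissibleChoice r' t A B := by
  rcases h with ⟨⟨h1, h2, h3⟩, _⟩ | ⟨_, h⟩
  · exact Or.inl ⟨h1, h2, fun i => (h3 i).trans (sub_le_sub_right (hr i) t)⟩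
  · exact Or.inr h

theorem Schedulable.of_imp {rule rule' : (Fin n → ℝ) → ℝ → Finset (Fin n) → Finset (Fin n) → Prop}
    (himp : ∀ φ t A B, rule φ t A B → rule' φ t A B) (h : τ.Schedulable rule') :
    τ.Schedulable rule := fun φ hφ ρ hρ =>
  h φ hφ ρ ⟨hρ.start_least, fun m => himp _ _ _ _ (hρ.batch_chosen m), hρ.dur_pos, hρ.dur_le⟩

end TaskSet

namespace Run

variable {n : ℕ} (ρ : Run n)

/-! ### Counting completed jobs. -/

theorem completed_succ (m : ℕ) (i : Fin n) :
    ρ.completed (m + 1) i = ρ.completed m i + if i ∈ ρ.batch m then 1 else 0 := by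
  simp only [completed, range_add_one, filter_insert]
  split_ifs <;> simp

theorem completed_mono (i : Fin n) : Monotone fun m => ρ.completed m i :=
  monotone_nat_of_le_succ fun m => by rw [completed_succ]; exact Nat.le_add_right _ _

/-- A job that is completed before the `M`-th execution was run by some earlier execution. -/
theorem exists_execution {M j : ℕ} {i : Fin n} (h : j < ρ.completed M i) :
    ∃ m < M, i ∈ ρ.batch m ∧ ρ.completed m i = j := by
  induction M with
  | zero => simp [completed] at h
  | succ M ih =>
    by_cases hj : j < ρ.completed M i
    · obtain ⟨m, hm, h'⟩ := ih hj
      exact ⟨m, hm.trans (Nat.lt_succ_self _), h'⟩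
    · rw [completed_succ] at h
      split_ifs at h with hb
      · exact ⟨M, Nat.lt_succ_self _, hb, by omega⟩
      · omega

/-- Every job of a task of priority at least that of `i` that was released before the start of the
`m`-th execution has been completed before it. -/
def Quiet (τ : TaskSet n) (φ : Fin n → ℝ) (i : Fin n) (m : ℕ) : Prop :=
  ∀ h ∈ τ.HEP i, ρ.start m ≤ τ.release φ h (ρ.completed m h)

variable {ρ} {τ : TaskSet n} {φ : Fin n → ℝ}

theorem mem_active {m : ℕ} {t : ℝ} {i : Fin n} :
    i ∈ ρ.active τ φ m t ↔ τ.release φ i (ρ.completed m i) ≤ t := by simp [active]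

theorem sum_completed_succ (k m : ℕ) (s : Finset (Fin n)) :
    ∑ h ∈ s, ((ρ.completed (m + 1) h : ℝ) - ρ.completed k h) * τ.C h
      = ∑ h ∈ s, ((ρ.completed m h : ℝ) - ρ.completed k h) * τ.C h
        + ∑ h ∈ s, if h ∈ ρ.batch m then τ.C h else 0 := by
  rw [← sum_add_distrib]
  refine sum_congr rfl fun h _ => ?_
  rw [completed_succ]
  split_ifs
  · push_cast; ring
  · push_cast; ring

namespace Follows

section AnyRule

variable {choice : ℝ → Finset (Fin n) → Finset (Fin n) → Prop}

/-! ### Consequences of work conservation. -/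

theorem freeFrom_le_start (hρ : ρ.Follows τ φ choice) (m : ℕ) : ρ.freeFrom m ≤ ρ.start m :=
  (hρ.start_least m).1.1

theorem start_lt_finish (hρ : ρ.Follows τ φ choice) (m : ℕ) : ρ.start m < ρ.finish m :=
  lt_add_of_pos_right _ (hρ.dur_pos m)

theorem start_strictMono (hρ : ρ.Follows τ φ choice) : StrictMono ρ.start :=
  strictMono_nat_of_lt_succ fun m => (hρ.start_lt_finish m).trans_le (hρ.freeFrom_le_start (m + 1))

theorem start_le_of_release (hρ : ρ.Follows τ φ choice) {m : ℕ} {t : ℝ} (h : Fin n)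
    (hf : ρ.freeFrom m ≤ t) (hr : τ.release φ h (ρ.completed m h) ≤ t) : ρ.start m ≤ t :=
  (hρ.start_least m).2 ⟨hf, h, mem_active.2 hr⟩

/-- The platform does not idle before an execution at whose start an older job is pending. -/
theorem start_eq_freeFrom_of_release_lt (hρ : ρ.Follows τ φ choice) {m : ℕ} {h : Fin n}
    (hr : τ.release φ h (ρ.completed m h) < ρ.start m) : ρ.start m = ρ.freeFrom m := by
  refine le_antisymm ?_ (hρ.freeFrom_le_start m)
  by_contra! hlt
  have := hρ.start_le_of_release (m := m) (t := max (ρ.freeFrom m)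
    (τ.release φ h (ρ.completed m h))) h (le_max_left _ _) (le_max_right _ _)
  exact absurd this (not_le.2 (max_lt hlt hr))

/-- Base point of the busy windows: the platform is free from `0`, before any first release, so the
first start waits for no later than the earliest one. -/
theorem quiet_zero (hρ : ρ.Follows τ φ choice) (hφ : ∀ i, 0 ≤ φ i) (i : Fin n) :
    ρ.Quiet τ φ i 0 := fun h _ =>
  hρ.start_le_of_release h (by
    have := hφ h
    simpa [freeFrom, TaskSet.release, completed] using this) le_rfl

end AnyRule

variable (hρ : ρ.Follows τ φ
  fun t A B => τ.AnyPermissibleChoice (fun i => τ.releaseAfter φ i t) t A B)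

include hρ

/-! ### What (P1) and (P2) say about one execution. -/

theorem isTopPrefix (m : ℕ) :
    τ.IsTopPrefix (ρ.active τ φ m (ρ.start m)) (ρ.batch m) := by
  rcases hρ.batch_chosen m with h | h
  exacts [h.2.1, h.2]

theorem batch_nonempty (m : ℕ) : (ρ.batch m).Nonempty := by
  rw [← card_pos]
  rcases hρ.batch_chosen m with h | h
  · have := h.1
    omega
  · have := h.1
    omega

theorem release_le_start_of_mem {m : ℕ} {i : Fin n} (hi : i ∈ ρ.batch m) :
    τ.release φ i (ρ.completed m i) ≤ ρ.start m :=
  mem_active.1 ((hρ.isTopPrefix m).1 hi)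

theorem release_le_start_of_lt_completed {p c : ℕ} {h : Fin n}
    (hc : c < ρ.completed (p + 1) h) : τ.release φ h c ≤ ρ.start p := by
  obtain ⟨m, hm, hb, rfl⟩ := ρ.exists_execution hc
  exact (hρ.release_le_start_of_mem hb).trans
    (hρ.start_strictMono.monotone (Nat.lt_succ_iff.1 hm))

/-- Only finitely many executions start in bounded time. -/
theorem exists_lt_start (t : ℝ) : ∃ m, t < ρ.start m := by
  by_contra! hle
  -- Each execution serves at least one released job, and at most `N h` jobs of `h` are released by
  -- `t`, so the number of executions is bounded.
  choose N hN using fun h => τ.exists_lt_release φ h t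
  have hcomp : ∀ m h, ρ.completed m h ≤ N h := by
    intro m h
    by_contra! hlt
    have h1 : N h < ρ.completed (m + 1) h :=
      hlt.trans_le (ρ.completed_mono h (Nat.le_succ m))
    exact absurd (hρ.release_le_start_of_lt_completed h1)
      (not_le.2 ((hle m).trans_lt (hN h)))
  have hsum : ∀ m, m ≤ ∑ h, ρ.completed m h := by
    intro m
    induction m with
    | zero => exact Nat.zero_le _
    | succ m ih =>
      have h1 : 0 < (ρ.batch m).card := card_pos.2 (hρ.batch_nonempty m)
      simp only [completed_succ, sum_add_distrib, sum_boole, filter_univ_mem, Nat.cast_id]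
      omega
  have := (hsum (∑ h, N h + 1)).trans (sum_le_sum fun h _ => hcomp _ h)
  omega

/-- This is how (P2) enters: the WCET bounds the actual duration. -/
theorem finish_le_release_of_permissible {m : ℕ}
    (hb : τ.IsPermissibleBatch (fun i => τ.releaseAfter φ i (ρ.start m)) (ρ.start m)
      (ρ.active τ φ m (ρ.start m)) (ρ.batch m)) {h : Fin n} {j : ℕ}
    (hj : ρ.start m < τ.release φ h j) : ρ.finish m ≤ τ.release φ h j := by
  have h1 := hρ.dur_le m
  rw [TaskSet.wcet, if_pos hb.1] at h1
  have h2 := hb.2.2 h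
  have h3 := τ.releaseAfter_le hj
  simp only [finish]
  linarith

/-- A permissible batch with a member of lower priority than `i` clears all pending work of priority
at least that of `i`, provided no such task has two jobs pending. -/
theorem quiet_succ_of_permissible {m : ℕ} {i l : Fin n}
    (hb : τ.IsPermissibleBatch (fun i => τ.releaseAfter φ i (ρ.start m)) (ρ.start m)
      (ρ.active τ φ m (ρ.start m)) (ρ.batch m)) (hl : l ∈ ρ.batch m) (hil : l ∉ τ.HEP i)
    (hbacklog : ∀ h ∈ τ.HEP i, ρ.start m < τ.release φ h (ρ.completed m h + 1)) :
    ρ.Quiet τ φ i (m + 1) := by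
  intro h hh
  -- The platform is free by the release of the oldest job left over, once that release is known to
  -- lie after the batch's start.
  refine hρ.start_le_of_release h (hρ.finish_le_release_of_permissible hb ?_) le_rfl
  rw [completed_succ]
  split_ifs with hmem
  · exact hbacklog h hh
  · by_contra! hle
    refine hmem ((hρ.isTopPrefix m).2 l hl h (mem_active.2 hle) ?_)
    rw [TaskSet.mem_HEP] at hh hil
    omega

/-- At an execution that is not quiet for `i`, a task of priority at least that of `i` is run. -/
theorem exists_mem_batch_of_not_quiet {m : ℕ} {i : Fin n} (hq : ¬ ρ.Quiet τ φ i m) :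
    ∃ h ∈ ρ.batch m, h ∈ τ.HEP i := by
  simp only [Quiet, not_forall, not_le] at hq
  obtain ⟨h, hh, hlt⟩ := hq
  obtain ⟨l, hl⟩ := hρ.batch_nonempty m
  by_cases hl' : l ∈ τ.HEP i
  · exact ⟨l, hl, hl'⟩
  · refine ⟨h, (hρ.isTopPrefix m).2 l hl h (mem_active.2 hlt.le) ?_, hh⟩
    rw [TaskSet.mem_HEP] at hh hl'
    omega

theorem dur_le_sum_of_subset (hbatch : τ.BatchingProperty) {m : ℕ} {i : Fin n}
    (hsub : ρ.batch m ⊆ τ.HEP i) :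
    ρ.dur m ≤ ∑ h ∈ τ.HEP i, if h ∈ ρ.batch m then τ.C h else 0 := by
  rw [← sum_filter, filter_mem_eq_inter, inter_eq_right.2 hsub]
  refine (hρ.dur_le m).trans ?_
  rw [TaskSet.wcet]
  split_ifs with hc
  exacts [hbatch _ hc, le_rfl]

/-- The work of one execution inside a busy window that starts at the quiet execution `k`. -/
theorem dur_le_of_window (hbatch : τ.BatchingProperty) {k m : ℕ} {i : Fin n}
    (hq : k < m → ¬ ρ.Quiet τ φ i m)
    (hnext : (ρ.batch m).card = 1 ∨ ¬ ρ.Quiet τ φ i (m + 1))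
    (hbacklog : ∀ h ∈ τ.HEP i, ρ.start m < τ.release φ h (ρ.completed m h + 1)) :
    ρ.dur m ≤ (if k < m then 0 else τ.blocking i)
      + ∑ h ∈ τ.HEP i, if h ∈ ρ.batch m then τ.C h else 0 := by
  have hB : 0 ≤ if k < m then 0 else τ.blocking i := by
    split_ifs
    exacts [le_rfl, τ.blocking_nonneg i]
  by_cases hsub : ρ.batch m ⊆ τ.HEP i
  · exact (hρ.dur_le_sum_of_subset hbatch hsub).trans (le_add_of_nonneg_left hB)
  obtain ⟨l, hl, hil⟩ := not_subset.1 hsub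
  -- A permissible batch reaching below `i` would make `m + 1` quiet, against `hnext`.
  have hcard : (ρ.batch m).card = 1 := by
    rcases hρ.batch_chosen m with h | h
    · exact hnext.resolve_right (not_not.2 (hρ.quiet_succ_of_permissible h hl hil hbacklog))
    · exact h.1
  obtain ⟨l', hl'⟩ := card_eq_one.1 hcard
  obtain rfl : l = l' := by simpa [hl'] using hl
  -- Blocking by a single lower-priority job can occur only at the quiet execution `k`, hence once.
  have hkm : ¬ k < m := fun hkm => by
    obtain ⟨h, hb, hh⟩ := hρ.exists_mem_batch_of_not_quiet (hq hkm)
    obtain rfl : h = l := by simpa [hl'] using hb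
    exact hil hh
  have h1 := hρ.dur_le m
  rw [TaskSet.wcet, if_neg (by omega), hl', sum_singleton] at h1
  have h2 : τ.C l ≤ τ.blocking i := τ.le_blocking (by rw [TaskSet.mem_HEP] at hil; omega)
  have h3 : 0 ≤ ∑ h ∈ τ.HEP i, if h ∈ ρ.batch m then τ.C h else 0 :=
    sum_nonneg fun h _ => by split_ifs; exacts [(τ.C_pos h).le, le_rfl]
  rw [if_neg hkm]
  linarith

/-! ### Length of a busy window. -/

/-- Within a busy window the elapsed time is covered by one blocking and the work done. -/
theorem finish_le_of_window (hbatch : τ.BatchingProperty) {k p : ℕ} {i : Fin n} (hkp : k ≤ p)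
    (hq : ∀ m, k < m → m ≤ p → ¬ ρ.Quiet τ φ i m)
    (hnext : (ρ.batch p).card = 1 ∨ ¬ ρ.Quiet τ φ i (p + 1))
    (hbacklog : ∀ m, k ≤ m → m ≤ p → ∀ h ∈ τ.HEP i,
      ρ.start m < τ.release φ h (ρ.completed m h + 1)) :
    ρ.finish p ≤ ρ.start k + τ.blocking i
      + ∑ h ∈ τ.HEP i, ((ρ.completed (p + 1) h : ℝ) - ρ.completed k h) * τ.C h := by
  induction p, hkp using Nat.le_induction with
  | base =>
    have := hρ.dur_le_of_window (k := k) hbatch (fun h => absurd h (lt_irrefl _)) hnext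
      (hbacklog k le_rfl le_rfl)
    rw [sum_completed_succ]
    simp only [lt_irrefl, if_false, sub_self, zero_mul, sum_const_zero] at this ⊢
    simp only [finish]
    linarith
  | succ p hkp ih =>
    have hlt : k < p + 1 := Nat.lt_succ_of_le hkp
    have hqp := hq (p + 1) hlt le_rfl
    have h1 := ih (fun m h h' => hq m h (h'.trans (Nat.le_succ p))) (Or.inr hqp)
      (fun m h h' => hbacklog m h (h'.trans (Nat.le_succ p)))
    have h2 := hρ.dur_le_of_window (k := k) hbatch (fun _ => hqp) hnext (hbacklog _ hlt.le le_rfl)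
    rw [if_pos hlt] at h2
    have h3 : ρ.start (p + 1) = ρ.finish p := by
      simp only [Quiet, not_forall, not_le] at hqp
      obtain ⟨h, _, hr⟩ := hqp
      exact hρ.start_eq_freeFrom_of_release_lt hr
    rw [sum_completed_succ]
    rw [finish, h3]
    linarith

/-- The jobs of `h` that are run within a window of length `R` after a quiet execution. -/
theorem completed_sub_le {k p : ℕ} {i h : Fin n} {R : ℝ} (hR : 0 < R) (hk : ρ.Quiet τ φ i k)
    (hh : h ∈ τ.HEP i) (hkp : k ≤ p) (hp : ρ.start p < ρ.start k + R) :
    (ρ.completed (p + 1) h : ℝ) - ρ.completed k h ≤ ((⌈R / τ.T h⌉ : ℤ) : ℝ) := by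
  have hmono : ρ.completed k h ≤ ρ.completed (p + 1) h :=
    ρ.completed_mono h (hkp.trans (Nat.le_succ p))
  rcases hmono.eq_or_lt with heq | hlt
  · rw [heq, sub_self]
    exact_mod_cast Int.ceil_nonneg (div_nonneg hR.le (τ.T_pos h).le)
  · obtain ⟨d, hd⟩ : ∃ d, ρ.completed (p + 1) h = d + 1 :=
      Nat.exists_eq_add_one_of_ne_zero (by omega)
    have h1 : τ.release φ h d < ρ.start k + R :=
      (hρ.release_le_start_of_lt_completed (by omega)).trans_lt hp
    have := τ.jobs_in_window_le (hk h hh) h1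
    rw [hd]
    push_cast
    linarith

/-- In a window of length at most `T i` after a quiet execution, no task of priority at least that of
`i` has two jobs pending, if the tasks of higher priority meet their deadlines. -/
theorem start_lt_release_succ {k p : ℕ} {i h : Fin n} {R : ℝ}
    (hRT : R ≤ τ.T i) (hk : ρ.Quiet τ φ i k) (hkp : k ≤ p) (hp : ρ.start p < ρ.start k + R)
    (ih : ∀ h, τ.prio h < τ.prio i → ∀ j, ∃ m, h ∈ ρ.batch m ∧ ρ.completed m h = j ∧
      ρ.finish m ≤ τ.deadline φ h j) (hh : h ∈ τ.HEP i) :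
    ρ.start p < τ.release φ h (ρ.completed p h + 1) := by
  rw [TaskSet.release_succ]
  rcases (τ.mem_HEP.1 hh).eq_or_lt with heq | hlt
  -- For `i` itself, the oldest uncompleted job is released no earlier than the window's start, and
  -- its successor `T i ≥ R` later.
  · obtain rfl := τ.prio_injective heq
    have h1 := (hk h hh).trans ((τ.release_strictMono φ h).monotone (ρ.completed_mono h hkp))
    simp only at h1
    linarith
  · obtain ⟨m, hm, hc, hf⟩ := ih h hlt (ρ.completed p h)
    -- The oldest uncompleted job runs at `p` or later and still ends by its deadline, the next
    -- release.
    have hpm : p ≤ m := by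
      by_contra! hmp
      have h1 : ρ.completed (m + 1) h ≤ ρ.completed p h := ρ.completed_mono h hmp
      rw [completed_succ, if_pos hm] at h1
      omega
    exact (hρ.start_strictMono.monotone hpm).trans_lt ((hρ.start_lt_finish m).trans_le hf)

/-- A busy window is shorter than the response-time bound. -/
theorem start_lt_of_window (hbatch : τ.BatchingProperty) {k p : ℕ} {i : Fin n} {R : ℝ}
    (hR : 0 < R) (hRT : R ≤ τ.T i)
    (hbound : τ.blocking i + ∑ h ∈ τ.HEP i, ((⌈R / τ.T h⌉ : ℤ) : ℝ) * τ.C h ≤ R)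
    (ih : ∀ h, τ.prio h < τ.prio i → ∀ j, ∃ m, h ∈ ρ.batch m ∧ ρ.completed m h = j ∧
      ρ.finish m ≤ τ.deadline φ h j)
    (hk : ρ.Quiet τ φ i k) (hkp : k ≤ p) (hq : ∀ m, k < m → m ≤ p → ¬ ρ.Quiet τ φ i m) :
    ρ.start p < ρ.start k + R := by
  induction p, hkp using Nat.le_induction with
  | base => exact lt_add_of_pos_right _ hR
  | succ p hkp ihp =>
    have hq' : ∀ m, k < m → m ≤ p → ¬ ρ.Quiet τ φ i m :=
      fun m h h' => hq m h (h'.trans (Nat.le_succ p))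
    have hp := ihp hq'
    have hqp := hq (p + 1) (Nat.lt_succ_of_le hkp) le_rfl
    have hfin := hρ.finish_le_of_window hbatch hkp hq' (Or.inr hqp) fun m hm hmp h hh =>
      hρ.start_lt_release_succ hRT hk hm
        ((hρ.start_strictMono.monotone hmp).trans_lt hp) ih hh
    simp only [Quiet, not_forall, not_le] at hqp
    obtain ⟨h, hh, hr⟩ := hqp
    have hstart : ρ.start (p + 1) = ρ.finish p := hρ.start_eq_freeFrom_of_release_lt hr
    have hle : ∀ g ∈ τ.HEP i, ((ρ.completed (p + 1) g : ℝ) - ρ.completed k g) * τ.C g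
        ≤ ((⌈R / τ.T g⌉ : ℤ) : ℝ) * τ.C g := fun g hg =>
      mul_le_mul_of_nonneg_right (hρ.completed_sub_le hR hk hg hkp hp) (τ.C_pos g).le
    have hle_start : ρ.start (p + 1) ≤ ρ.start k + R := by
      have := sum_le_sum hle
      linarith
    -- The pending job of `h` is released in the window but not yet run, so the work done falls
    -- short of the bound by at least `C h`; this makes the inequality strict.
    have hjobs := τ.jobs_in_window_le
      (hk h hh) (hr.trans_le hle_start)
    have := sum_lt_sum hle ⟨h, hh, mul_lt_mul_of_pos_right (by linarith) (τ.C_pos h)⟩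
    linarith

/-! ### Deadlines, by induction on priority. -/

/-- If the tasks of higher priority meet their deadlines, then so does `i`. -/
theorem meets_deadline_of_higher_priority (hφ : ∀ i, 0 ≤ φ i) (hbatch : τ.BatchingProperty)
    (htest : τ.PassesResponseTimeTest) {i : Fin n}
    (ih : ∀ h, τ.prio h < τ.prio i → ∀ j, ∃ m, h ∈ ρ.batch m ∧ ρ.completed m h = j ∧
      ρ.finish m ≤ τ.deadline φ h j) (j : ℕ) :
    ∃ m, i ∈ ρ.batch m ∧ ρ.completed m i = j ∧ ρ.finish m ≤ τ.deadline φ i j := by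
  classical
  obtain ⟨R, hR, hRT, hbound⟩ := τ.exists_busy_window_bound htest i
  have hi : i ∈ τ.HEP i := τ.mem_HEP.2 le_rfl
  have last_quiet : ∀ M, ∃ k ≤ M, ρ.Quiet τ φ i k ∧
      ∀ m, k < m → m ≤ M → ¬ ρ.Quiet τ φ i m := fun M =>
    ⟨_, Nat.findGreatest_le M, Nat.findGreatest_spec (Nat.zero_le M) (hρ.quiet_zero hφ i),
      fun _ h h' => Nat.findGreatest_is_greatest h h'⟩
  -- Without a later quiet execution the window would never end, although its starts stay below
  -- `start k + R`.
  obtain ⟨M, hM, hquiet⟩ : ∃ M, τ.release φ i j < ρ.start M ∧ ρ.Quiet τ φ i M := by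
    obtain ⟨M, hM⟩ := hρ.exists_lt_start (τ.release φ i j)
    by_contra! hno
    obtain ⟨k, hkM, hk, hlast⟩ := last_quiet M
    obtain ⟨P, hP⟩ := hρ.exists_lt_start (ρ.start k + R)
    have hkP : k ≤ P := by
      by_contra! h
      have := hρ.start_strictMono h
      linarith
    refine absurd (hρ.start_lt_of_window hbatch hR hRT hbound ih hk hkP fun m h _ => ?_)
      (not_lt.2 hP.le)
    rcases le_total m M with h' | h'
    · exact hlast m h h'
    · exact hno m (hM.trans_le (hρ.start_strictMono.monotone h'))
  have hdone : j < ρ.completed M i :=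
    (τ.release_strictMono φ i).lt_iff_lt.1 (hM.trans_le (hquiet i hi))
  obtain ⟨m, -, hmem, rfl⟩ := ρ.exists_execution hdone
  refine ⟨m, hmem, rfl, ?_⟩
  obtain ⟨k, hkm, hk, hlast⟩ := last_quiet m
  have hstart := hρ.start_lt_of_window hbatch hR hRT hbound ih hk hkm hlast
  have hbacklog : ∀ p, k ≤ p → p ≤ m → ∀ h ∈ τ.HEP i,
      ρ.start p < τ.release φ h (ρ.completed p h + 1) := fun p hp hpm h hh =>
    hρ.start_lt_release_succ hRT hk hp ((hρ.start_strictMono.monotone hpm).trans_lt hstart) ih hh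
  rw [TaskSet.deadline, ← TaskSet.release_succ]
  -- A batch is done by the next release of `i` through (P2); a single job is covered by the window
  -- bound.
  rcases hρ.batch_chosen m with hb | hb
  · exact hρ.finish_le_release_of_permissible hb (hbacklog m hkm le_rfl i hi)
  · have hfin := hρ.finish_le_of_window hbatch hkm hlast (Or.inl hb.1) hbacklog
    have hle := sum_le_sum fun g (hg : g ∈ τ.HEP i) => mul_le_mul_of_nonneg_right
      (hρ.completed_sub_le hR hk hg hkm hstart) (τ.C_pos g).le
    have hrel : ρ.start k ≤ τ.release φ i (ρ.completed m i) :=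
      (hk i hi).trans ((τ.release_strictMono φ i).monotone (ρ.completed_mono i hkm))
    rw [TaskSet.release_succ]
    linarith

theorem meetsAllDeadlines (hφ : ∀ i, 0 ≤ φ i) (hbatch : τ.BatchingProperty)
    (htest : τ.PassesResponseTimeTest) : ρ.MeetsAllDeadlines τ φ := by
  intro i
  induction hp : τ.prio i using Nat.strong_induction_on generalizing i with
  | _ p ih =>
    subst hp
    exact hρ.meets_deadline_of_higher_priority hφ hbatch htest fun h hh => ih _ hh h rfl

end Follows

end Run

end

/-- The coarse batch algorithm keeps the task set schedulable, whether the next release is counted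
strictly after or at-or-after the scheduling instant, and so does every rule that batches only as
(P1) and (P2) permit. -/
theorem lemma2 {n : ℕ} (τ : TaskSet n) (hbatch : τ.BatchingProperty)
    (htest : τ.PassesResponseTimeTest) :
    τ.Schedulable (fun φ t A B => τ.AlgorithmChoice (fun i => τ.releaseAfter φ i t) t A B) ∧
    τ.Schedulable (fun φ t A B => τ.AlgorithmChoice (fun i => τ.releaseAtOrAfter φ i t) t A B) ∧
    τ.Schedulable (fun φ t A B => τ.AnyPermissibleChoice (fun i => τ.releaseAfter φ i t) t A B) := by

  have h : τ.Schedulable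
      (fun φ t A B => τ.AnyPermissibleChoice (fun i => τ.releaseAfter φ i t) t A B) :=
    fun _ hφ _ hρ => hρ.meetsAllDeadlines hφ hbatch htest
  refine ⟨?_, ?_, h⟩
  · exact h.of_imp τ fun φ t A B => TaskSet.AlgorithmChoice.anyPermissibleChoice τ fun _ => le_rfl
  -- An earlier next release only makes (P2) stricter.
  · exact h.of_imp τ fun φ t A B => TaskSet.AlgorithmChoice.anyPermissibleChoice τ
      fun i => τ.releaseAtOrAfter_le_releaseAfter φ i t
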